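/- Let $\mathfrak{R}=\mathbb{Z}_4+v\mathbb{Z}_4=\mathbb{Z}_4[v]/\langle v^2-v\rangle$. A cyclic code of length $n$ over $\mathfrak{R}$ is an $\mathfrak{R}$-submodule $C\subseteq\mathfrak{R}^n$ such that $(c_{n-1},c_0,\dots,c_{n-2})\in C$ whenever $(c_0,c_1,\dots,c_{n-1})\in C$. Its dual is $C^{\perp}=\{h\in\mathfrak{R}^n : \sum_{i=0}^{n-1}h_ik_i=0 \text{ for all } k\in C\}$, its hull is $\mathrm{Hull}(C)=C\cap C^{\perp}$, and the $2$-dimension of a code $D\subseteq\mathfrak{R}^n$ is $\dim_2(D)=\log_2|D|$. Let $\mathcal{C}_n$ be the finite set of all cyclic codes of length $n$ over $\mathfrak{R}$, and let $$E(n)=\frac{1}{|\mathcal{C}_n|}\sum_{C\in\mathcal{C}_n}\dim_2(\mathrm{Hull}(C))$$ be the average $2$-dimension of their hulls. Then for every odd positive integer $n$, $$E(n)<\frac{10n}{9}.$$ -/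

import Mathlib

namespace CyclicHull

/-- The ring `ℤ₄ + vℤ₄ = ℤ₄[v] / ⟨v² - v⟩`. -/
abbrev Z4v : Type := AdjoinRoot (Polynomial.X ^ 2 - Polynomial.X : Polynomial (ZMod 4))

instance finite_Z4v : Finite Z4v := by
  have hm : (Polynomial.X ^ 2 - Polynomial.X : Polynomial (ZMod 4)).Monic := by
    monicity!
  have : Module.Finite (ZMod 4) Z4v := hm.finite_adjoinRoot
  exact Module.finite_of_finite (ZMod 4)

/-- A linear code `C` of length `n` over `A` (a submodule of `Aⁿ`) is cyclic if it contains with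
each word `(c₀, c₁, …, cₙ₋₁)` its cyclic shift `(cₙ₋₁, c₀, …, cₙ₋₂)`. -/
def IsCyclicCode {A : Type} [CommRing A] {n : ℕ} (C : Submodule A (Fin n → A)) : Prop :=
  ∀ c ∈ C, (fun i => c ((finRotate n).symm i)) ∈ C

/-- The dual code with respect to the inner product `h · k = h₀k₀ + ⋯ + hₙ₋₁kₙ₋₁`. -/
def dualCode {A : Type} [CommRing A] {n : ℕ} (C : Submodule A (Fin n → A)) :
    Submodule A (Fin n → A) where
  carrier := {h | ∀ k ∈ C, ∑ i, h i * k i = 0}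
  zero_mem' := by
    intro k _
    simp
  add_mem' := by
    intro a b ha hb k hk
    simp [add_mul, Finset.sum_add_distrib, ha k hk, hb k hk]
  smul_mem' := by
    intro r a ha k hk
    simp [mul_assoc, ← Finset.mul_sum, ha k hk]

/-- The hull of a code is its intersection with its dual. -/
def hull {A : Type} [CommRing A] {n : ℕ} (C : Submodule A (Fin n → A)) :
    Submodule A (Fin n → A) :=
  C ⊓ dualCode C

/-- The 2-dimension of a finite code: the base-2 logarithm of its number of words. -/
noncomputable def twoDim {A : Type} [CommRing A] {n : ℕ} (C : Submodule A (Fin n → A)) : ℝ :=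
  Real.logb 2 (Nat.card C)

/-- The cyclic codes of length `n` over `ℤ₄ + vℤ₄`. -/
def CyclicCode (n : ℕ) : Type :=
  {C : Submodule Z4v (Fin n → Z4v) // IsCyclicCode C}

instance finite_cyclicCode (n : ℕ) : Finite (CyclicCode n) :=
  inferInstanceAs (Finite {C : Submodule Z4v (Fin n → Z4v) // IsCyclicCode C})

noncomputable instance fintype_cyclicCode (n : ℕ) : Fintype (CyclicCode n) :=
  Fintype.ofFinite _

/-- `E(n)`: the average 2-dimension of the hulls of all cyclic codes of length `n`
over `ℤ₄ + vℤ₄`. -/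
noncomputable def averageHullDim (n : ℕ) : ℝ :=
  (∑ C : CyclicCode n, twoDim (hull C.1)) / (Fintype.card (CyclicCode n) : ℝ)

end CyclicHull

/-! Cyclic codes of length n are the ideals of the group algebra S of the cyclic group of order n
over ℤ₄ + vℤ₄ (`cyclicCodeEquiv`). If σ inverts group elements, the dual of the code of I is the
σ-preimage of the annihilator of I (`IsCyclicCode.mem_dualCode_iff`).

For n odd, S is unramified modulo 4 (`IsBooleanMod4.isUnramifiedMod4`). Locally at each maximal
ideal m, an ideal is therefore 0, (2) or everything, of length 0, 1 or 2; these lengths can be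
prescribed freely and determine the ideal (`idealType_injective`, `idealType_surjective`). If I has
length a at m and b at the conjugate of m, the hull has length min(a, 2 - b) at m
(`logb_card_idealHull`).

Averaged over independent a and b this is 5/9; at a self-conjugate m, where a = b, it is only 1/3.
Weighted by residue degrees, whose sum is log₂|S| / 2 = 2n, this bounds the average by 10n/9. The
inequality is strict because the augmentation provides a self-conjugate maximal ideal
(`exists_conjMaximal_inversion_eq`). -/

namespace CyclicHull

/-- A ring in which `4 = 0`, the annihilator of `2` is `(2)`, and the Jacobson radical is `(2)`:
for finite rings, these are the finite products of Galois rings of characteristic `4`. -/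
structure IsUnramifiedMod4 (S : Type*) [CommRing S] : Prop where
  four_eq_zero : (4 : S) = 0
  two_dvd_of_two_mul : ∀ x : S, 2 * x = 0 → 2 ∣ x
  two_dvd_of_mem : ∀ x : S, (∀ m : MaximalSpectrum S, x ∈ m.asIdeal) → 2 ∣ x

/-- The colon ideal `(I : 2)`. -/
def halfIdeal {S : Type*} [CommRing S] (I : Ideal S) : Ideal S :=
  Submodule.comap (LinearMap.mulLeft S (2 : S)) I

/-! ### Local behaviour of ideals, colon ideals and annihilators at maximal ideals -/

section Ideals

variable {S : Type*} [CommRing S]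

lemma mem_halfIdeal {I : Ideal S} {x : S} : x ∈ halfIdeal I ↔ 2 * x ∈ I := Iff.rfl

lemma halfIdeal_inf (I J : Ideal S) : halfIdeal (I ⊓ J) = halfIdeal I ⊓ halfIdeal J := rfl

lemma le_halfIdeal (I : Ideal S) : I ≤ halfIdeal I := fun _ hx => I.mul_mem_left 2 hx

lemma not_inf_le_iff (I J : Ideal S) (m : MaximalSpectrum S) :
    ¬ I ⊓ J ≤ m.asIdeal ↔ ¬ I ≤ m.asIdeal ∧ ¬ J ≤ m.asIdeal := by
  rw [m.isMaximal.isPrime.inf_le, not_or]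

namespace IsUnramifiedMod4

variable (hS : IsUnramifiedMod4 S)
include hS

lemma two_mem (m : MaximalSpectrum S) : (2 : S) ∈ m.asIdeal := by
  have h : (2 : S) * 2 ∈ m.asIdeal := by
    have : (2 : S) * 2 = 0 := by rw [← hS.four_eq_zero]; norm_num
    rw [this]; exact zero_mem _
  exact (m.isMaximal.isPrime.mem_or_mem h).elim id id

lemma mem_of_two_dvd {x : S} (hx : 2 ∣ x) (m : MaximalSpectrum S) : x ∈ m.asIdeal :=
  m.asIdeal.mem_of_dvd hx (hS.two_mem m)

lemma two_mul_two_mul (x : S) : 2 * (2 * x) = 0 := by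
  linear_combination x * hS.four_eq_zero

/-- Every maximal ideal becomes `(2)` after inverting a suitable element. -/
lemma exists_notMem_two_dvd_mul [Finite S] (m : MaximalSpectrum S) :
    ∃ e ∉ m.asIdeal, ∀ x ∈ m.asIdeal, 2 ∣ e * x := by
  classical
  have := Fintype.ofFinite (MaximalSpectrum S)
  have h : ∀ m' : MaximalSpectrum S, ∃ a, a ∉ m.asIdeal ∧ (m' ≠ m → a ∈ m'.asIdeal) := by
    intro m'
    by_cases hm : m' = m
    · exact ⟨1, fun h1 => m.isMaximal.ne_top ((Ideal.eq_top_iff_one _).2 h1), fun h => (h hm).elim⟩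
    · have : ¬ m'.asIdeal ≤ m.asIdeal := fun hle =>
        hm (MaximalSpectrum.ext (m'.isMaximal.eq_of_le m.isMaximal.ne_top hle))
      obtain ⟨a, ha, ha'⟩ := SetLike.not_le_iff_exists.1 this
      exact ⟨a, ha', fun _ => ha⟩
  choose a ha ha' using h
  -- The product avoids m by primality, and its multiple by x ∈ m lies in every maximal ideal, hence
  -- in (2).
  refine ⟨∏ m', a m', fun hmem => ?_, fun x hx => hS.two_dvd_of_mem _ fun m' => ?_⟩
  · obtain ⟨m', -, hm'⟩ := (m.isMaximal.isPrime.prod_mem_iff).1 hmem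
    exact ha m' hm'
  · by_cases hm : m' = m
    · exact hm ▸ Ideal.mul_mem_left _ _ hx
    · exact Ideal.mul_mem_right _ _
        (Ideal.prod_mem _ (Finset.mem_univ m') (ha' m' hm))

/-- Both sides say that I vanishes locally at m: only then is its annihilator locally everything,
and only then is (I : 2) locally proper. -/
lemma not_annihilator_le_iff [Finite S] (I : Ideal S) (m : MaximalSpectrum S) :
    ¬ Submodule.annihilator I ≤ m.asIdeal ↔ halfIdeal I ≤ m.asIdeal := by
  constructor
  · intro h x hx
    obtain ⟨a, ha, ham⟩ := SetLike.not_le_iff_exists.1 h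
    have h0 : a * (2 * x) = 0 := Submodule.mem_annihilator.1 ha _ hx
    have h2 := hS.mem_of_two_dvd (hS.two_dvd_of_two_mul (a * x) (by rw [← h0]; ring)) m
    exact (m.isMaximal.isPrime.mem_or_mem h2).resolve_left ham
  · intro h hle
    obtain ⟨e, he, hem⟩ := hS.exists_notMem_two_dvd_mul m
    -- Each factor e extracts one factor 2 from an element of I, and 4 = 0.
    have hmem : e * e ∈ Submodule.annihilator I := by
      refine Submodule.mem_annihilator.2 fun x hx => ?_
      obtain ⟨y, hy⟩ := hem x (h (le_halfIdeal I hx))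
      have hyI : y ∈ halfIdeal I := by
        rw [mem_halfIdeal, ← hy]; exact I.mul_mem_left _ hx
      obtain ⟨z, hz⟩ := hem y (h hyI)
      have : e * e * x = 2 * (2 * z) := by
        rw [mul_assoc, hy, ← hz]; ring
      rw [smul_eq_mul, this, hS.two_mul_two_mul]
    exact (m.isMaximal.isPrime.mem_or_mem (hle hmem)).elim he he

/-- Both sides say that I is locally proper at m, hence contained in (2) and killed by 2. -/
lemma not_halfIdeal_annihilator_le_iff [Finite S] (I : Ideal S) (m : MaximalSpectrum S) :
    ¬ halfIdeal (Submodule.annihilator I) ≤ m.asIdeal ↔ I ≤ m.asIdeal := by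
  constructor
  · intro h x hx
    obtain ⟨a, ha, ham⟩ := SetLike.not_le_iff_exists.1 h
    have h0 : 2 * a * x = 0 := Submodule.mem_annihilator.1 ha _ hx
    have h2 := hS.mem_of_two_dvd (hS.two_dvd_of_two_mul (a * x) (by rw [← h0]; ring)) m
    exact (m.isMaximal.isPrime.mem_or_mem h2).resolve_left ham
  · intro h hle
    obtain ⟨e, he, hem⟩ := hS.exists_notMem_two_dvd_mul m
    refine he (hle ?_)
    rw [mem_halfIdeal]
    refine Submodule.mem_annihilator.2 fun x hx => ?_
    obtain ⟨y, hy⟩ := hem x (h hx)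
    rw [smul_eq_mul, mul_assoc, hy, hS.two_mul_two_mul]

/-- Modulo 2 the ring is a product of fields, so ideals containing 2 are intersections of maximal
ideals. This makes the Chinese remainder theorem applicable to S/J. -/
lemma mem_of_forall_mem [Finite S] {J : Ideal S} (h2 : (2 : S) ∈ J) {x : S}
    (hx : ∀ m : MaximalSpectrum S, J ≤ m.asIdeal → x ∈ m.asIdeal) : x ∈ J := by
  by_contra hxJ
  have hne : J.colon {x} ≠ ⊤ := by
    intro h
    have : (1 : S) ∈ J.colon {x} := h ▸ Submodule.mem_top
    rw [Submodule.mem_colon_singleton] at this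
    exact hxJ (by simpa using this)
  obtain ⟨M, hM, hle⟩ := Ideal.exists_le_maximal _ hne
  let m : MaximalSpectrum S := ⟨M, hM⟩
  have hJm : J ≤ m.asIdeal := fun j hj => hle (by
    rw [Submodule.mem_colon_singleton, smul_eq_mul]; exact J.mul_mem_right _ hj)
  obtain ⟨e, he, hem⟩ := hS.exists_notMem_two_dvd_mul m
  refine he (hle ?_)
  rw [Submodule.mem_colon_singleton, smul_eq_mul]
  exact J.mem_of_dvd (hem x (hx m hJm)) h2

open scoped Classical in
lemma card_quotient [Finite S] [Fintype (MaximalSpectrum S)] {J : Ideal S} (h2 : (2 : S) ∈ J) :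
    Nat.card (S ⧸ J) =
      ∏ m : MaximalSpectrum S, if J ≤ m.asIdeal then Nat.card (S ⧸ m.asIdeal) else 1 := by
  have hinf : J = ⨅ m : {m : MaximalSpectrum S // J ≤ m.asIdeal}, m.1.asIdeal := by
    refine le_antisymm (le_iInf fun m => m.2) fun x hx => ?_
    rw [Ideal.mem_iInf] at hx
    exact hS.mem_of_forall_mem h2 fun m hm => hx ⟨m, hm⟩
  have hcop : Pairwise fun i j : {m : MaximalSpectrum S // J ≤ m.asIdeal} =>
      IsCoprime i.1.asIdeal j.1.asIdeal := by
    intro i j hij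
    refine (Ideal.isCoprime_iff_sup_eq).2 (i.1.isMaximal.coprime_of_ne j.1.isMaximal fun h => ?_)
    exact hij (Subtype.ext (MaximalSpectrum.ext h))
  have e := Ideal.quotientInfRingEquivPiQuotient _ hcop
  rw [← hinf] at e
  rw [Nat.card_congr e.toEquiv, Nat.card_pi, Finset.prod_ite, Finset.prod_const_one, mul_one]
  exact (Finset.prod_subtype (Finset.univ.filter fun m : MaximalSpectrum S => J ≤ m.asIdeal)
    (by simp) fun m => Nat.card (S ⧸ m.asIdeal)).symm

end IsUnramifiedMod4
end Ideals
-- Cardinality of an ideal from its local lengths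
lemma card_eq_card_inf_ker_mul_card_map {R M N : Type*} [Ring R] [AddCommGroup M] [Module R M]
    [AddCommGroup N] [Module R N] (f : M →ₗ[R] N) (I : Submodule R M) :
    Nat.card I = Nat.card (I ⊓ LinearMap.ker f : Submodule R M) * Nat.card (I.map f) := by
  have h := Submodule.card_eq_card_quotient_mul_card (LinearMap.ker (f.domRestrict I))
  rw [h, Nat.card_congr (f.domRestrict I).quotKerEquivRange.toEquiv, LinearMap.range_domRestrict]
  congr 1
  exact Nat.card_congr
    { toFun := fun x => ⟨x.1.1, x.1.2, x.2⟩
      invFun := fun x => ⟨⟨x.1, x.2.1⟩, x.2.2⟩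
      left_inv := fun _ => rfl
      right_inv := fun _ => rfl }

/-- The dimension of the residue field at `m` over the prime field with two elements. -/
noncomputable def residueDim {S : Type*} [CommRing S] (m : MaximalSpectrum S) : ℝ :=
  Real.logb 2 (Nat.card (S ⧸ m.asIdeal))

namespace IsUnramifiedMod4

variable {S : Type*} [CommRing S] (hS : IsUnramifiedMod4 S)
include hS

lemma ker_mulLeft_two : LinearMap.ker (LinearMap.mulLeft S (2 : S)) = Ideal.span {2} := by
  ext x
  rw [LinearMap.mem_ker, Ideal.mem_span_singleton]
  refine ⟨hS.two_dvd_of_two_mul x, ?_⟩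
  rintro ⟨y, rfl⟩
  exact hS.two_mul_two_mul y

lemma card_eq_sq : Nat.card S = Nat.card (Ideal.span {(2 : S)}) ^ 2 := by
  have h := card_eq_card_inf_ker_mul_card_map (LinearMap.mulLeft S (2 : S)) ⊤
  have hr : Submodule.map (LinearMap.mulLeft S (2 : S)) ⊤ = Ideal.span {(2 : S)} := by
    ext x
    simp [Ideal.mem_span_singleton, dvd_def, eq_comm]
  rw [hr, hS.ker_mulLeft_two, top_inf_eq, ← sq] at h
  rw [← h]
  exact (Nat.card_congr Submodule.topEquiv.toEquiv).symm

lemma two_mem_halfIdeal (I : Ideal S) : (2 : S) ∈ halfIdeal I := by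
  have h : (2 : S) * 2 = 0 := by rw [← hS.four_eq_zero]; norm_num
  rw [mem_halfIdeal, h]
  exact zero_mem _

/-- Multiplication by 2 maps (I : 2) onto I ∩ (2) with kernel (2), and I / (I ∩ (2)) ≅ (I + (2)) /
(2). Counting I is thus reduced to two ideals containing 2. -/
lemma card_mul_sq [Finite S] (I : Ideal S) :
    Nat.card I * Nat.card (Ideal.span {(2 : S)}) ^ 2 =
      Nat.card (I ⊔ Ideal.span {2} : Ideal S) * Nat.card (halfIdeal I) := by
  have h1 := card_eq_card_inf_ker_mul_card_map (LinearMap.mulLeft S (2 : S)) (halfIdeal I)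
  have h2 := card_eq_card_inf_ker_mul_card_map (Ideal.span {(2 : S)}).mkQ I
  have h3 := card_eq_card_inf_ker_mul_card_map (Ideal.span {(2 : S)}).mkQ (I ⊔ Ideal.span {2})
  have hr : Submodule.map (LinearMap.mulLeft S (2 : S)) (halfIdeal I) = I ⊓ Ideal.span {2} := by
    rw [halfIdeal, Submodule.map_comap_eq, inf_comm]
    congr 1
    ext x
    simp [Ideal.mem_span_singleton, dvd_def, eq_comm]
  have hle : Ideal.span {(2 : S)} ≤ halfIdeal I := by
    rw [Ideal.span_singleton_le_iff_mem]
    exact hS.two_mem_halfIdeal I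
  have hm : Submodule.map (Ideal.span {(2 : S)}).mkQ (I ⊔ Ideal.span {2}) =
      Submodule.map (Ideal.span {(2 : S)}).mkQ I := by
    rw [Submodule.map_sup, Submodule.mkQ_map_self, sup_bot_eq]
  rw [hr, hS.ker_mulLeft_two, inf_eq_right.2 hle] at h1
  rw [Submodule.ker_mkQ] at h2
  rw [hm, Submodule.ker_mkQ, inf_eq_right.2 le_sup_right] at h3
  rw [h1, h2, h3]
  ring

open scoped Classical in
lemma logb_card_of_two_mem [Finite S] [Fintype (MaximalSpectrum S)] {J : Ideal S}
    (h2 : (2 : S) ∈ J) :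
    Real.logb 2 (Nat.card J) = Real.logb 2 (Nat.card S) -
      ∑ m : MaximalSpectrum S, if J ≤ m.asIdeal then residueDim m else 0 := by
  have h := Submodule.card_eq_card_quotient_mul_card J
  rw [hS.card_quotient h2] at h
  have hpos : ∀ m : MaximalSpectrum S,
      ((if J ≤ m.asIdeal then Nat.card (S ⧸ m.asIdeal) else 1 : ℕ) : ℝ) ≠ 0 := by
    intro m
    split_ifs
    · have := Finite.of_surjective _ (Ideal.Quotient.mk_surjective (I := m.asIdeal))
      exact Nat.cast_ne_zero.2 Nat.card_pos.ne'
    · norm_num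
  have hJ : (Nat.card J : ℝ) ≠ 0 := Nat.cast_ne_zero.2 Nat.card_pos.ne'
  rw [h]
  push_cast [-Nat.cast_ite]
  rw [Real.logb_mul hJ (Finset.prod_ne_zero_iff.2 fun m _ => hpos m)]
  rw [Real.logb_prod _ _ fun m _ => hpos m]
  rw [eq_sub_iff_add_eq]
  congr 1
  refine Finset.sum_congr rfl fun m _ => ?_
  split_ifs
  · rfl
  · simp

open scoped Classical in
lemma logb_card_eq_two_mul_sum [Finite S] [Fintype (MaximalSpectrum S)] :
    Real.logb 2 (Nat.card S) = 2 * ∑ m : MaximalSpectrum S, residueDim m := by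
  have h := hS.logb_card_of_two_mem (J := Ideal.span {2}) (Ideal.mem_span_singleton_self _)
  have h1 : ∀ m : MaximalSpectrum S, Ideal.span {(2 : S)} ≤ m.asIdeal := fun m => by
    rw [Ideal.span_singleton_le_iff_mem]; exact hS.two_mem m
  simp only [h1, if_true] at h
  have h2 : Real.logb 2 (Nat.card S) = 2 * Real.logb 2 (Nat.card (Ideal.span {(2 : S)})) := by
    rw [hS.card_eq_sq, Nat.cast_pow, Real.logb_pow]; norm_num
  linarith

open scoped Classical in
lemma logb_card_ideal [Finite S] [Fintype (MaximalSpectrum S)] (I : Ideal S) :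
    Real.logb 2 (Nat.card I) = ∑ m : MaximalSpectrum S, residueDim m *
      ((if I ≤ m.asIdeal then 0 else 1) + (if halfIdeal I ≤ m.asIdeal then 0 else 1)) := by
  have h2 : (2 : S) ∈ I ⊔ Ideal.span {2} :=
    (le_sup_right : _ ≤ I ⊔ Ideal.span {2}) (Ideal.mem_span_singleton_self _)
  have hh : (2 : S) ∈ halfIdeal I := hS.two_mem_halfIdeal I
  have hc : ∀ J : Ideal S, (Nat.card J : ℝ) ≠ 0 := fun J => Nat.cast_ne_zero.2 Nat.card_pos.ne'
  have h := congrArg (fun k : ℕ => Real.logb 2 (k : ℝ)) (hS.card_mul_sq I)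
  rw [← hS.card_eq_sq] at h
  simp only [Nat.cast_mul] at h
  rw [Real.logb_mul (hc _) (Nat.cast_ne_zero.2 Nat.card_pos.ne'), Real.logb_mul (hc _) (hc _),
    hS.logb_card_of_two_mem h2, hS.logb_card_of_two_mem hh] at h
  have hle : ∀ m : MaximalSpectrum S, I ⊔ Ideal.span {2} ≤ m.asIdeal ↔ I ≤ m.asIdeal := by
    intro m
    rw [sup_le_iff, Ideal.span_singleton_le_iff_mem, and_iff_left (hS.two_mem m)]
  simp only [hle] at h
  have h3 := hS.logb_card_eq_two_mul_sum
  have h4 : ∀ m : MaximalSpectrum S, residueDim m *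
      ((if I ≤ m.asIdeal then (0 : ℝ) else 1) + (if halfIdeal I ≤ m.asIdeal then 0 else 1)) =
      2 * residueDim m - (if I ≤ m.asIdeal then residueDim m else 0) -
        (if halfIdeal I ≤ m.asIdeal then residueDim m else 0) := by
    intro m
    split_ifs <;> ring
  simp only [h4, Finset.sum_sub_distrib, ← Finset.mul_sum]
  linarith

end IsUnramifiedMod4
-- Averages over independent uniform coordinates
section PairAverage

variable {ι : Type*} [Fintype ι] [DecidableEq ι]

/-- The sum is invariant under translating t at i and j; adding up the nine translates makes the
summand independent of t. -/
lemma nine_mul_sum_pair (g : Fin 3 → Fin 3 → ℝ) {i j : ι} (hij : i ≠ j) :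
    9 * ∑ t : ι → Fin 3, g (t i) (t j) = 3 ^ Fintype.card ι * ∑ a, ∑ b, g a b := by
  have h1 : ∀ a b : Fin 3, ∑ t : ι → Fin 3, g (t i) (t j) =
      ∑ t : ι → Fin 3, g (t i + a) (t j + b) := by
    intro a b
    rw [← Equiv.sum_comp (Equiv.addRight (Pi.single i a + Pi.single j b : ι → Fin 3))]
    simp [hij, hij.symm]
  have h2 : ∑ _a : Fin 3, ∑ _b : Fin 3, ∑ t : ι → Fin 3, g (t i) (t j) =
      ∑ t : ι → Fin 3, ∑ a, ∑ b, g (t i + a) (t j + b) := by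
    rw [Finset.sum_congr rfl fun a _ => Finset.sum_congr rfl fun b _ => h1 a b,
      Finset.sum_congr rfl fun a _ => Finset.sum_comm, Finset.sum_comm]
  have h3 : ∀ c d : Fin 3, ∑ a, ∑ b, g (c + a) (d + b) = ∑ a, ∑ b, g a b := by
    intro c d
    rw [← Equiv.sum_comp (Equiv.addLeft c) fun a => ∑ b, g a b]
    refine Finset.sum_congr rfl fun a _ => ?_
    exact Equiv.sum_comp (Equiv.addLeft d) fun b => g (c + a) b
  rw [Finset.sum_congr rfl fun (t : ι → Fin 3) _ => h3 (t i) (t j)] at h2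
  simp only [Finset.sum_const, Finset.card_univ, Fintype.card_fin, Fintype.card_fun,
    nsmul_eq_mul] at h2
  push_cast at h2
  linarith

lemma three_mul_sum_apply (g : Fin 3 → ℝ) (i : ι) :
    3 * ∑ t : ι → Fin 3, g (t i) = 3 ^ Fintype.card ι * ∑ a, g a := by
  have h1 : ∀ a : Fin 3, ∑ t : ι → Fin 3, g (t i) = ∑ t : ι → Fin 3, g (t i + a) := by
    intro a
    rw [← Equiv.sum_comp (Equiv.addRight (Pi.single i a : ι → Fin 3))]
    simp
  have h2 : ∑ _a : Fin 3, ∑ t : ι → Fin 3, g (t i) = ∑ t : ι → Fin 3, ∑ a, g (t i + a) := by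
    rw [Finset.sum_congr rfl fun a _ => h1 a, Finset.sum_comm]
  have h3 : ∀ c : Fin 3, ∑ a, g (c + a) = ∑ a, g a := fun c => Equiv.sum_comp (Equiv.addLeft c) g
  rw [Finset.sum_congr rfl fun (t : ι → Fin 3) _ => h3 (t i)] at h2
  simp only [Finset.sum_const, Finset.card_univ, Fintype.card_fin, Fintype.card_fun,
    nsmul_eq_mul] at h2
  push_cast at h2
  linarith

end PairAverage

/-! ### Classification of ideals by local type, and the average hull -/

open scoped Classical in
/-- The exponent `2 - a` at each maximal ideal `m`, where `I` becomes `(2 ^ a)` in `S_m`. -/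
noncomputable def idealType {S : Type*} [CommRing S] (I : Ideal S) (m : MaximalSpectrum S) :
    Fin 3 :=
  if I ≤ m.asIdeal then if halfIdeal I ≤ m.asIdeal then 0 else 1 else 2

section IdealType

variable {S : Type*} [CommRing S]

lemma idealType_eq_two_iff (I : Ideal S) (m : MaximalSpectrum S) :
    idealType I m = 2 ↔ ¬ I ≤ m.asIdeal := by
  unfold idealType
  split_ifs <;> simp_all

lemma idealType_eq_zero_iff (I : Ideal S) (m : MaximalSpectrum S) :
    idealType I m = 0 ↔ halfIdeal I ≤ m.asIdeal := by
  unfold idealType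
  split_ifs with h1 h2
  · simp_all
  · simp_all
  · simpa using fun h => h1 ((le_halfIdeal I).trans h)

/-- The contribution of a maximal ideal to the dimension of the hull, given the types of the
ideal at that maximal ideal and at its conjugate. -/
noncomputable def hullWeight (a b : Fin 3) : ℝ :=
  (if a = 2 ∧ b = 0 then 1 else 0) + (if a ≠ 0 ∧ b ≠ 2 then 1 else 0)

/-- The weight is min(a, 2 - b), so its mean over independent types is 5/9. -/
lemma sum_hullWeight : ∑ a, ∑ b, hullWeight a b = 5 := by
  simp [hullWeight, Fin.sum_univ_three]
  norm_num

/-- Only a = 1 contributes to min(a, 2 - a); the resulting mean 1/3 < 5/9 is the source of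
strictness. -/
lemma sum_hullWeight_diag : ∑ a, hullWeight a a = 1 := by
  simp [hullWeight, Fin.sum_univ_three]

/-- The hull of an ideal with respect to a ring automorphism. -/
def idealHull (σ : S ≃+* S) (I : Ideal S) : Ideal S :=
  I ⊓ (Submodule.annihilator I).comap σ

/-- The image of a maximal ideal under a ring automorphism. -/
def conjMaximal (σ : S ≃+* S) (m : MaximalSpectrum S) : MaximalSpectrum S :=
  ⟨m.asIdeal.comap σ.symm,
    have := m.isMaximal
    Ideal.comap_isMaximal_of_surjective σ.symm σ.symm.surjective⟩

lemma comap_le_iff_le_conjMaximal (σ : S ≃+* S) (J : Ideal S) (m : MaximalSpectrum S) :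
    J.comap σ ≤ m.asIdeal ↔ J ≤ (conjMaximal σ m).asIdeal := by
  constructor
  · intro h x hx
    exact h (show σ (σ.symm x) ∈ J by simpa using hx)
  · intro h x hx
    have : σ.symm (σ x) ∈ m.asIdeal := h hx
    simpa using this

lemma halfIdeal_comap (σ : S ≃+* S) (J : Ideal S) :
    halfIdeal (J.comap σ) = (halfIdeal J).comap σ := by
  ext x
  simp [mem_halfIdeal, map_ofNat]

namespace IsUnramifiedMod4

variable (hS : IsUnramifiedMod4 S)
include hS

lemma card_eq_of_idealType_eq [Finite S] {I K : Ideal S} (h : idealType I = idealType K) :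
    Nat.card I = Nat.card K := by
  classical
  have := Fintype.ofFinite (MaximalSpectrum S)
  have h1 : ∀ m : MaximalSpectrum S, I ≤ m.asIdeal ↔ K ≤ m.asIdeal := fun m => by
    rw [← not_iff_not, ← idealType_eq_two_iff, ← idealType_eq_two_iff, h]
  have h2 : ∀ m : MaximalSpectrum S, halfIdeal I ≤ m.asIdeal ↔ halfIdeal K ≤ m.asIdeal :=
    fun m => by rw [← idealType_eq_zero_iff, ← idealType_eq_zero_iff, h]
  have hlog : Real.logb 2 (Nat.card I) = Real.logb 2 (Nat.card K) := by
    rw [hS.logb_card_ideal, hS.logb_card_ideal]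
    simp only [h1, h2]
  have := Real.logb_injOn_pos (by norm_num : (1 : ℝ) < 2)
    (Set.mem_Ioi.2 (Nat.cast_pos.2 Nat.card_pos)) (Set.mem_Ioi.2 (Nat.cast_pos.2 Nat.card_pos)) hlog
  exact_mod_cast this

/-- If I and K have the same type, so does I ∩ K; since types determine cardinality, I ∩ K equals
both. -/
lemma idealType_injective [Finite S] :
    Function.Injective (idealType : Ideal S → MaximalSpectrum S → Fin 3) := by
  intro I K h
  have hinf : idealType (I ⊓ K) = idealType I := by
    funext m
    have hm := congrFun h m
    have h1 : I ≤ m.asIdeal ↔ K ≤ m.asIdeal := by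
      rw [← not_iff_not, ← idealType_eq_two_iff, ← idealType_eq_two_iff, hm]
    have h2 : halfIdeal I ≤ m.asIdeal ↔ halfIdeal K ≤ m.asIdeal := by
      rw [← idealType_eq_zero_iff, ← idealType_eq_zero_iff, hm]
    have h3 : I ⊓ K ≤ m.asIdeal ↔ I ≤ m.asIdeal := by
      rw [m.isMaximal.isPrime.inf_le, ← h1, or_self]
    have h4 : halfIdeal (I ⊓ K) ≤ m.asIdeal ↔ halfIdeal I ≤ m.asIdeal := by
      rw [halfIdeal_inf, m.isMaximal.isPrime.inf_le, ← h2, or_self]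
    classical
    simp only [idealType, h3, h4]
  have key : ∀ J : Ideal S, I ⊓ K ≤ J → idealType (I ⊓ K) = idealType J → I ⊓ K = J := by
    intro J hle hJ
    refine SetLike.coe_injective (Set.eq_of_subset_of_ncard_le hle ?_ (Set.toFinite _))
    exact (hS.card_eq_of_idealType_eq hJ).ge
  exact (key I inf_le_left hinf).symm.trans (key K inf_le_right (hinf.trans h))

lemma idealType_surjective [Finite S] :
    Function.Surjective (idealType : Ideal S → MaximalSpectrum S → Fin 3) := by
  classical
  have := Fintype.ofFinite (MaximalSpectrum S)
  intro t
  have hle : ∀ (p : MaximalSpectrum S → Prop) (m : MaximalSpectrum S),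
      (Finset.univ.filter p).inf MaximalSpectrum.asIdeal ≤ m.asIdeal ↔ p m := by
    intro p m
    rw [m.isMaximal.isPrime.inf_le']
    constructor
    · rintro ⟨m', hm', h⟩
      have : m' = m := MaximalSpectrum.ext (m'.isMaximal.eq_of_le m.isMaximal.ne_top h)
      exact this ▸ (Finset.mem_filter.1 hm').2
    · exact fun h => ⟨m, by simpa using h, le_rfl⟩
  -- The witness is X² + 2Y. Where t = 2, X is locally everything; elsewhere X² is locally 0, and 2Y
  -- is locally (2) or 0 according to whether t = 1 or t = 0.
  obtain ⟨X, hX⟩ : ∃ X : Ideal S, ∀ m : MaximalSpectrum S, X ≤ m.asIdeal ↔ t m ≠ 2 :=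
    ⟨_, hle fun m => t m ≠ 2⟩
  obtain ⟨Y, hY⟩ : ∃ Y : Ideal S, ∀ m : MaximalSpectrum S, Y ≤ m.asIdeal ↔ t m = 0 :=
    ⟨_, hle fun m => t m = 0⟩
  have h1 : ∀ m : MaximalSpectrum S, X * X ⊔ Ideal.span {2} * Y ≤ m.asIdeal ↔ t m ≠ 2 := by
    intro m
    rw [sup_le_iff, m.isMaximal.isPrime.mul_le, or_self, hX m, and_iff_left]
    exact (Ideal.mul_le_left : Ideal.span {2} * Y ≤ Ideal.span {2}).trans (by
      rw [Ideal.span_singleton_le_iff_mem]; exact hS.two_mem m)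
  have h2 : ∀ m : MaximalSpectrum S,
      halfIdeal (X * X ⊔ Ideal.span {2} * Y) ≤ m.asIdeal ↔ t m = 0 := by
    intro m
    constructor
    · intro h
      refine (hY m).1 fun y hy => h ?_
      rw [mem_halfIdeal]
      exact Ideal.mem_sup_right (Ideal.mul_mem_mul (Ideal.mem_span_singleton_self _) hy)
    · intro h x hx
      rw [mem_halfIdeal] at hx
      obtain ⟨a, ha, b', hb', hab⟩ := Submodule.mem_sup.1 hx
      obtain ⟨b, hb, rfl⟩ := Ideal.mem_span_singleton_mul.1 hb'
      obtain ⟨e, he, hem⟩ := hS.exists_notMem_two_dvd_mul m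
      have hXm : X ≤ m.asIdeal := (hX m).2 (by rw [h]; decide)
      have hea : e * e * a = 0 := by
        refine Submodule.mul_induction_on ha (fun u hu v hv => ?_) fun u v hu hv => ?_
        · obtain ⟨u', hu'⟩ := hem u (hXm hu)
          obtain ⟨v', hv'⟩ := hem v (hXm hv)
          have : e * e * (u * v) = 2 * (2 * (u' * v')) := by
            linear_combination (e * v) * hu' + 2 * u' * hv'
          rw [this, hS.two_mul_two_mul]
        · rw [mul_add, hu, hv, add_zero]
      have h0 : 2 * (e * e * (x - b)) = 0 := by
        linear_combination hea - e * e * hab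
      have hmem := hS.mem_of_two_dvd (hS.two_dvd_of_two_mul _ h0) m
      have hpr := m.isMaximal.isPrime
      have hxb := (hpr.mem_or_mem hmem).resolve_left fun h => (hpr.mem_or_mem h).elim he he
      have := add_mem hxb ((hY m).2 h hb)
      rwa [sub_add_cancel] at this
  refine ⟨X * X ⊔ Ideal.span {2} * Y, funext fun m => ?_⟩
  unfold idealType
  have ht : t m = 0 ∨ t m = 1 ∨ t m = 2 := by
    generalize t m = a
    revert a
    decide
  rcases ht with h | h | h <;> simp [h1, h2, h]

lemma logb_card_idealHull [Finite S] [Fintype (MaximalSpectrum S)] (σ : S ≃+* S) (I : Ideal S) :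
    Real.logb 2 (Nat.card (idealHull σ I)) = ∑ m : MaximalSpectrum S,
      residueDim m * hullWeight (idealType I m) (idealType I (conjMaximal σ m)) := by
  classical
  rw [hS.logb_card_ideal]
  refine Finset.sum_congr rfl fun m _ => ?_
  -- The hull is locally everything at m exactly when I is everything at m and its annihilator is
  -- everything, that is I is zero, at the conjugate. Taking colons by 2 detects nonvanishing in the
  -- same way.
  have h1 : idealHull σ I ≤ m.asIdeal ↔
      ¬ (idealType I m = 2 ∧ idealType I (conjMaximal σ m) = 0) := by
    rw [idealType_eq_two_iff, idealType_eq_zero_iff, ← hS.not_annihilator_le_iff,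
      ← comap_le_iff_le_conjMaximal, ← not_inf_le_iff, not_not, idealHull]
  have h2 : halfIdeal (idealHull σ I) ≤ m.asIdeal ↔
      ¬ (idealType I m ≠ 0 ∧ idealType I (conjMaximal σ m) ≠ 2) := by
    rw [ne_eq, ne_eq, idealType_eq_two_iff, idealType_eq_zero_iff, not_not,
      ← hS.not_halfIdeal_annihilator_le_iff I, ← comap_le_iff_le_conjMaximal, ← not_inf_le_iff,
      not_not, idealHull, halfIdeal_inf, halfIdeal_comap]
  rw [hullWeight]
  simp only [h1, h2, ite_not]

/-- The constant 5/18 is half of the mean 5/9, because log₂|S| is twice the sum of the residue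
degrees. -/
theorem sum_logb_card_idealHull_lt [Finite S] [Fintype (Ideal S)] (σ : S ≃+* S)
    (m₀ : MaximalSpectrum S) (hm₀ : conjMaximal σ m₀ = m₀) :
    ∑ I : Ideal S, Real.logb 2 (Nat.card (idealHull σ I)) <
      Fintype.card (Ideal S) * (5 / 18 * Real.logb 2 (Nat.card S)) := by
  classical
  have := Fintype.ofFinite (MaximalSpectrum S)
  let e := Equiv.ofBijective _ ⟨hS.idealType_injective, hS.idealType_surjective⟩
  have hcard : (Fintype.card (Ideal S) : ℝ) = 3 ^ Fintype.card (MaximalSpectrum S) := by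
    rw [Fintype.card_congr e]
    simp
  have hsum : ∑ I : Ideal S, Real.logb 2 (Nat.card (idealHull σ I)) =
      ∑ m : MaximalSpectrum S, residueDim m *
        ∑ t : MaximalSpectrum S → Fin 3, hullWeight (t m) (t (conjMaximal σ m)) := by
    simp only [hS.logb_card_idealHull, Finset.mul_sum]
    rw [Finset.sum_comm]
    refine Finset.sum_congr rfl fun m _ => ?_
    exact Equiv.sum_comp e fun t => residueDim m * hullWeight (t m) (t (conjMaximal σ m))
  have hpow : (0 : ℝ) < 3 ^ Fintype.card (MaximalSpectrum S) := by positivity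
  have hfix : ∀ m : MaximalSpectrum S, conjMaximal σ m = m →
      ∑ t : MaximalSpectrum S → Fin 3, hullWeight (t m) (t (conjMaximal σ m)) <
        5 / 9 * 3 ^ Fintype.card (MaximalSpectrum S) := by
    intro m hm
    have := three_mul_sum_apply (fun a => hullWeight a a) m
    rw [sum_hullWeight_diag] at this
    rw [hm]
    linarith
  have hle : ∀ m : MaximalSpectrum S,
      ∑ t : MaximalSpectrum S → Fin 3, hullWeight (t m) (t (conjMaximal σ m)) ≤
        5 / 9 * 3 ^ Fintype.card (MaximalSpectrum S) := by
    intro m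
    by_cases hm : conjMaximal σ m = m
    · exact (hfix m hm).le
    · have := nine_mul_sum_pair hullWeight (Ne.symm hm)
      rw [sum_hullWeight] at this
      linarith
  have hdim : ∀ m : MaximalSpectrum S, 0 < residueDim m := by
    intro m
    have := Finite.of_surjective _ (Ideal.Quotient.mk_surjective (I := m.asIdeal))
    have := Ideal.Quotient.nontrivial_iff.2 m.isMaximal.ne_top
    exact Real.logb_pos (by norm_num) (by exact_mod_cast Finite.one_lt_card)
  rw [hsum, hcard, hS.logb_card_eq_two_mul_sum, Finset.mul_sum, Finset.mul_sum, Finset.mul_sum]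
  refine Finset.sum_lt_sum (fun m _ => ?_) ⟨m₀, Finset.mem_univ _, ?_⟩
  · have := mul_le_mul_of_nonneg_left (hle m) (hdim m).le
    linarith
  · have := mul_lt_mul_of_pos_left (hfix m₀ hm₀) (hdim m₀)
    linarith

end IsUnramifiedMod4
end IdealType
-- The coefficient ring ℤ₄ + vℤ₄
section Base

/-- The conditions on a coefficient ring under which its group algebras over groups of odd order
are unramified modulo `4`. -/
structure IsBooleanMod4 (A : Type*) [CommRing A] : Prop where
  four_eq_zero : (4 : A) = 0
  two_dvd_of_two_mul : ∀ a : A, 2 * a = 0 → 2 ∣ a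
  two_dvd_sq_sub : ∀ a : A, 2 ∣ a ^ 2 - a

lemma monic_X_sq_sub_X : (Polynomial.X ^ 2 - Polynomial.X : Polynomial (ZMod 4)).Monic := by
  monicity!

lemma natDegree_X_sq_sub_X :
    (Polynomial.X ^ 2 - Polynomial.X : Polynomial (ZMod 4)).natDegree = 2 := by
  compute_degree!

/-- The basis `1, v` of `ℤ₄ + vℤ₄`. -/
noncomputable def basisZ4v :
    Module.Basis (Fin (AdjoinRoot.powerBasis' monic_X_sq_sub_X).dim) (ZMod 4) Z4v :=
  (AdjoinRoot.powerBasis' monic_X_sq_sub_X).basis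

lemma card_Z4v : Nat.card Z4v = 16 := by
  rw [Nat.card_congr basisZ4v.equivFun.toEquiv]
  simp [natDegree_X_sq_sub_X]

lemma isBooleanMod4_Z4v : IsBooleanMod4 Z4v where
  four_eq_zero := by
    rw [← map_ofNat (algebraMap (ZMod 4) Z4v) 4, show (OfNat.ofNat 4 : ZMod 4) = 0 from rfl,
      map_zero]
  two_dvd_of_two_mul a ha := by
    have hc : ∀ i, ∃ c, basisZ4v.repr a i = 2 * c := by
      intro i
      have h2 : (2 : ZMod 4) • a = 0 := by
        rw [Algebra.smul_def, map_ofNat (algebraMap (ZMod 4) Z4v) 2, ha]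
      have h : 2 * basisZ4v.repr a i = 0 := by
        simpa using congrArg (fun x => basisZ4v.repr x i) h2
      generalize basisZ4v.repr a i = c at h
      revert c
      decide
    choose c hc using hc
    refine ⟨∑ i, c i • basisZ4v i, ?_⟩
    rw [← basisZ4v.sum_repr a, Finset.mul_sum]
    refine Finset.sum_congr rfl fun i _ => ?_
    rw [hc, mul_smul, Algebra.smul_def, map_ofNat]
  two_dvd_sq_sub a := by
    induction a using AdjoinRoot.induction_on with
    | ih p =>
      induction p using Polynomial.induction_on with
      | C c =>
        rw [AdjoinRoot.mk_C, ← map_pow, ← map_sub]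
        have : (2 : ZMod 4) ∣ c ^ 2 - c := by revert c; decide
        have h := map_dvd (algebraMap (ZMod 4) Z4v) this
        rwa [map_ofNat (algebraMap (ZMod 4) Z4v) 2] at h
      | add p q hp hq =>
        obtain ⟨x, hx⟩ := hp
        obtain ⟨y, hy⟩ := hq
        rw [map_add]
        exact ⟨x + y + AdjoinRoot.mk _ p * AdjoinRoot.mk _ q, by linear_combination hx + hy⟩
      | monomial n c hc =>
        obtain ⟨x, hx⟩ := hc
        have hv : AdjoinRoot.mk (Polynomial.X ^ 2 - Polynomial.X : Polynomial (ZMod 4))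
            Polynomial.X ^ 2 = AdjoinRoot.mk _ Polynomial.X := by
          rw [← sub_eq_zero, ← map_pow, ← map_sub, AdjoinRoot.mk_self]
        rw [pow_succ Polynomial.X n, ← mul_assoc, map_mul]
        refine ⟨x * AdjoinRoot.mk _ Polynomial.X, ?_⟩
        rw [mul_pow, hv]
        linear_combination AdjoinRoot.mk _ Polynomial.X * hx

end Base

/-! ### Group algebras over groups of odd order -/

section GroupAlgebra

variable {A G : Type*} [CommRing A] [AddCommGroup G]

lemma coeff_two_mul (x : AddMonoidAlgebra A G) (g : G) :
    (2 * x).coeff g = 2 * x.coeff g := by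
  rw [two_mul, two_mul, AddMonoidAlgebra.coeff_add, Finsupp.add_apply]

lemma two_dvd_iff_coeff [Finite G] (x : AddMonoidAlgebra A G) :
    2 ∣ x ↔ ∀ g, 2 ∣ x.coeff g := by
  constructor
  · rintro ⟨y, rfl⟩ g
    exact ⟨y.coeff g, coeff_two_mul y g⟩
  · intro h
    choose y hy using h
    refine ⟨.ofCoeff (Finsupp.equivFunOnFinite.symm y), ?_⟩
    ext g
    rw [coeff_two_mul, hy]
    rfl

/-- Modulo 2, squaring is additive and fixes coefficients, so it only doubles the exponents. -/
lemma IsBooleanMod4.two_dvd_sq_sub_mapDomain (hA : IsBooleanMod4 A) (x : AddMonoidAlgebra A G) :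
    2 ∣ x ^ 2 - AddMonoidAlgebra.mapDomain (fun g => g + g) x := by
  induction x using AddMonoidAlgebra.induction_linear with
  | zero => simp
  | add x y hx hy =>
    obtain ⟨u, hu⟩ := hx
    obtain ⟨w, hw⟩ := hy
    rw [AddMonoidAlgebra.mapDomain_add]
    exact ⟨u + w + x * y, by linear_combination hu + hw⟩
  | single g a =>
    obtain ⟨b, hb⟩ := hA.two_dvd_sq_sub a
    refine ⟨AddMonoidAlgebra.single (g + g) b, ?_⟩
    rw [AddMonoidAlgebra.mapDomain_single, sq, AddMonoidAlgebra.single_mul_single, two_mul,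
      ← AddMonoidAlgebra.single_add, ← two_mul, ← hb, sq]
    rw [sub_eq_iff_eq_add, ← AddMonoidAlgebra.single_add, sub_add_cancel]

/-- When doubling is injective on G, squaring modulo 2 merely moves coefficients to distinct places,
so the group algebra is reduced modulo 2. -/
lemma IsBooleanMod4.two_dvd_of_two_dvd_sq [Finite G] (hA : IsBooleanMod4 A)
    (hG : Function.Injective fun g : G => g + g) {x : AddMonoidAlgebra A G} (hx : 2 ∣ x ^ 2) :
    2 ∣ x := by
  have h := (dvd_sub_right hx).1 (hA.two_dvd_sq_sub_mapDomain x)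
  rw [two_dvd_iff_coeff] at h ⊢
  intro g
  have := h (g + g)
  rwa [AddMonoidAlgebra.coeff_mapDomain, Finsupp.mapDomain_apply hG] at this

instance finite_addMonoidAlgebra [Finite A] [Finite G] : Finite (AddMonoidAlgebra A G) :=
  Finite.of_equiv (G → A)
    (Finsupp.equivFunOnFinite.symm.trans AddMonoidAlgebra.coeffEquiv.symm)

theorem IsBooleanMod4.isUnramifiedMod4 [Finite A] [Finite G] (hA : IsBooleanMod4 A)
    (hG : Function.Injective fun g : G => g + g) : IsUnramifiedMod4 (AddMonoidAlgebra A G) where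
  four_eq_zero := by
    have h : algebraMap A (AddMonoidAlgebra A G) 4 = 0 := by rw [hA.four_eq_zero, map_zero]
    rwa [map_ofNat] at h
  two_dvd_of_two_mul x hx := by
    rw [two_dvd_iff_coeff]
    intro g
    refine hA.two_dvd_of_two_mul _ ?_
    rw [← coeff_two_mul, hx]
    rfl
  two_dvd_of_mem x hx := by
    have hnil : IsNilpotent x := by
      rw [nilpotent_iff_mem_prime]
      intro J hJ
      exact hx ⟨J, Ideal.isMaximal_of_isPrime J⟩
    obtain ⟨k, hk⟩ := hnil
    -- Reducedness modulo 2, iterated: an element of all maximal ideals is nilpotent, so some x ^ 2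
    -- ^ j is 0.
    have hdvd : ∀ j, 2 ∣ x ^ 2 ^ j → 2 ∣ x := by
      intro j
      induction j with
      | zero => simp
      | succ j ih =>
        intro h
        rw [pow_succ, pow_mul] at h
        exact ih (hA.two_dvd_of_two_dvd_sq hG h)
    refine hdvd k ?_
    rw [pow_eq_zero_of_le Nat.lt_two_pow_self.le hk]
    exact dvd_zero 2

end GroupAlgebra
open AddMonoidAlgebra (single)

/-! ### Cyclic codes as ideals, duality as annihilation -/

section Codes

variable {A : Type} [CommRing A] {k : ℕ}

lemma IsCyclicCode.shift_mem {C : Submodule A (Fin (k + 1) → A)} (hC : IsCyclicCode C)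
    {c : Fin (k + 1) → A} (hc : c ∈ C) (g : Fin (k + 1)) : (fun i => c (i - g)) ∈ C := by
  induction g using Fin.induction with
  | zero => simpa using hc
  | succ g ih =>
    have := hC _ ih
    convert this using 2 with i
    have hi : (finRotate (k + 1)).symm i = i - 1 := by
      rw [Equiv.symm_apply_eq, finRotate_apply, sub_add_cancel]
    rw [hi, ← Fin.coeSucc_eq_succ]
    congr 1
    abel

/-- The words of length `k + 1` as elements of the group algebra of the cyclic group. -/
noncomputable def wordEquiv (A : Type) [CommRing A] (k : ℕ) :
    AddMonoidAlgebra A (Fin (k + 1)) ≃ (Fin (k + 1) → A) :=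
  AddMonoidAlgebra.coeffEquiv.trans Finsupp.equivFunOnFinite

lemma wordEquiv_apply (x : AddMonoidAlgebra A (Fin (k + 1))) (i : Fin (k + 1)) :
    wordEquiv A k x i = x.coeff i := rfl

lemma wordEquiv_add (x y : AddMonoidAlgebra A (Fin (k + 1))) :
    wordEquiv A k (x + y) = wordEquiv A k x + wordEquiv A k y := rfl

lemma wordEquiv_symm_zero : (wordEquiv A k).symm 0 = 0 := by
  rw [Equiv.symm_apply_eq]
  rfl

lemma wordEquiv_symm_add (c d : Fin (k + 1) → A) :
    (wordEquiv A k).symm (c + d) = (wordEquiv A k).symm c + (wordEquiv A k).symm d := by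
  rw [Equiv.symm_apply_eq, wordEquiv_add, Equiv.apply_symm_apply, Equiv.apply_symm_apply]

lemma wordEquiv_single_mul (g : Fin (k + 1)) (a : A) (x : AddMonoidAlgebra A (Fin (k + 1))) :
    wordEquiv A k (single g a * x) = a • fun i => wordEquiv A k x (i - g) := by
  funext i
  rw [wordEquiv_apply, AddMonoidAlgebra.coeff_single_mul_apply, neg_add_eq_sub]
  rfl

/-- The ideal of the group algebra corresponding to a cyclic code. -/
noncomputable def IsCyclicCode.toIdeal {C : Submodule A (Fin (k + 1) → A)} (hC : IsCyclicCode C) :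
    Ideal (AddMonoidAlgebra A (Fin (k + 1))) where
  carrier := {x | wordEquiv A k x ∈ C}
  zero_mem' := C.zero_mem
  add_mem' hx hy := C.add_mem hx hy
  smul_mem' s x hx := by
    rw [smul_eq_mul]
    induction s using AddMonoidAlgebra.induction_linear with
    | zero => rw [zero_mul]; exact C.zero_mem
    | add s t hs ht => rw [add_mul]; exact C.add_mem hs ht
    | single g a =>
      rw [Set.mem_ofPred_eq, wordEquiv_single_mul]
      exact C.smul_mem a (hC.shift_mem hx g)

lemma IsCyclicCode.mem_toIdeal {C : Submodule A (Fin (k + 1) → A)} (hC : IsCyclicCode C)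
    {x : AddMonoidAlgebra A (Fin (k + 1))} : x ∈ hC.toIdeal ↔ wordEquiv A k x ∈ C := Iff.rfl

/-- The cyclic code corresponding to an ideal of the group algebra. -/
noncomputable def codeOfIdeal (I : Ideal (AddMonoidAlgebra A (Fin (k + 1)))) :
    Submodule A (Fin (k + 1) → A) where
  carrier := {c | (wordEquiv A k).symm c ∈ I}
  zero_mem' := by
    rw [Set.mem_ofPred_eq, wordEquiv_symm_zero]
    exact I.zero_mem
  add_mem' {c d} hc hd := by
    rw [Set.mem_ofPred_eq, wordEquiv_symm_add]
    exact I.add_mem hc hd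
  smul_mem' a c hc := by
    have h : (wordEquiv A k).symm (a • c) = single 0 a * (wordEquiv A k).symm c := by
      rw [Equiv.symm_apply_eq, wordEquiv_single_mul]
      simp
    rw [Set.mem_ofPred_eq, h]
    exact I.mul_mem_left _ hc

lemma mem_codeOfIdeal {I : Ideal (AddMonoidAlgebra A (Fin (k + 1)))} {c : Fin (k + 1) → A} :
    c ∈ codeOfIdeal I ↔ (wordEquiv A k).symm c ∈ I := Iff.rfl

lemma isCyclicCode_codeOfIdeal (I : Ideal (AddMonoidAlgebra A (Fin (k + 1)))) :
    IsCyclicCode (codeOfIdeal I) := by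
  intro c hc
  have h : (wordEquiv A k).symm (fun i => c ((finRotate (k + 1)).symm i)) =
      single 1 1 * (wordEquiv A k).symm c := by
    rw [Equiv.symm_apply_eq, wordEquiv_single_mul, one_smul, Equiv.apply_symm_apply]
    funext i
    congr 1
    rw [Equiv.symm_apply_eq, finRotate_apply, sub_add_cancel]
  rw [mem_codeOfIdeal, h]
  exact I.mul_mem_left _ hc

/-- Cyclic codes are the ideals of the group algebra of the cyclic group. -/
noncomputable def cyclicCodeEquiv (A : Type) [CommRing A] (k : ℕ) :
    {C : Submodule A (Fin (k + 1) → A) // IsCyclicCode C} ≃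
      Ideal (AddMonoidAlgebra A (Fin (k + 1))) where
  toFun C := C.2.toIdeal
  invFun I := ⟨codeOfIdeal I, isCyclicCode_codeOfIdeal I⟩
  left_inv C := by
    refine Subtype.ext (SetLike.ext fun c => ?_)
    rw [mem_codeOfIdeal, IsCyclicCode.mem_toIdeal, Equiv.apply_symm_apply]
  right_inv I := by
    ext x
    rw [IsCyclicCode.mem_toIdeal, mem_codeOfIdeal, Equiv.symm_apply_apply]

/-- The involution of the group algebra inverting the elements of the group. -/
noncomputable def inversion (A : Type) [CommRing A] (k : ℕ) :
    AddMonoidAlgebra A (Fin (k + 1)) ≃+* AddMonoidAlgebra A (Fin (k + 1)) :=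
  (AddMonoidAlgebra.domCongr A A (AddEquiv.neg (Fin (k + 1)))).toRingEquiv

lemma coeff_inversion (x : AddMonoidAlgebra A (Fin (k + 1))) (g : Fin (k + 1)) :
    (inversion A k x).coeff g = x.coeff (-g) :=
  AddMonoidAlgebra.coeff_domCongr (R := A) (AddEquiv.neg (Fin (k + 1))) x g

lemma inversion_symm : (inversion A k).symm = inversion A k := rfl

lemma coeff_inversion_mul (x y : AddMonoidAlgebra A (Fin (k + 1))) (g : Fin (k + 1)) :
    (inversion A k x * y).coeff g = ∑ i, wordEquiv A k x i * wordEquiv A k y (i + g) := by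
  rw [AddMonoidAlgebra.coeff_mul_apply_left, Finsupp.sum_fintype _ _ fun _ => zero_mul _,
    ← Equiv.sum_comp (Equiv.neg (Fin (k + 1)))]
  refine Finset.sum_congr rfl fun i _ => ?_
  simp [coeff_inversion, wordEquiv_apply]

/-- The coefficients of σ(x)y are the inner products of x with all shifts of y. As C is closed under
shifts, orthogonality to C amounts to the vanishing of all these products. -/
lemma IsCyclicCode.mem_dualCode_iff {C : Submodule A (Fin (k + 1) → A)} (hC : IsCyclicCode C)
    (x : AddMonoidAlgebra A (Fin (k + 1))) :
    wordEquiv A k x ∈ dualCode C ↔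
      x ∈ (Submodule.annihilator hC.toIdeal).comap (inversion A k) := by
  rw [Ideal.mem_comap, Submodule.mem_annihilator]
  constructor
  · intro h y hy
    rw [smul_eq_mul]
    ext g
    rw [coeff_inversion_mul]
    have := h _ (hC.shift_mem hy (-g))
    simp only [sub_neg_eq_add] at this
    exact this
  · intro h c hc
    have h1 := h ((wordEquiv A k).symm c) (by
      rwa [hC.mem_toIdeal, Equiv.apply_symm_apply])
    have h2 := coeff_inversion_mul x ((wordEquiv A k).symm c) 0
    rw [← smul_eq_mul, h1] at h2
    simpa using h2.symm

lemma IsCyclicCode.card_hull {C : Submodule A (Fin (k + 1) → A)} (hC : IsCyclicCode C) :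
    Nat.card (hull C) = Nat.card (idealHull (inversion A k) hC.toIdeal) := by
  refine (Nat.card_congr ((wordEquiv A k).subtypeEquiv fun x => ?_)).symm
  exact and_congr Iff.rfl (hC.mem_dualCode_iff x).symm

/-- The augmentation, sending every group element to 1, does not see inversion; hence preimages
under it of maximal ideals of A are self-conjugate. -/
lemma exists_conjMaximal_inversion_eq [Nontrivial A] :
    ∃ m : MaximalSpectrum (AddMonoidAlgebra A (Fin (k + 1))),
      conjMaximal (inversion A k) m = m := by
  obtain ⟨M, hM⟩ := Ideal.exists_maximal A
  let ε : AddMonoidAlgebra A (Fin (k + 1)) →ₐ[A] A := AddMonoidAlgebra.lift A A (Fin (k + 1)) 1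
  have hε : Function.Surjective ε := fun a => ⟨single 0 a, by simp [ε]⟩
  have hinv : ∀ x, ε (inversion A k x) = ε x := by
    intro x
    induction x using AddMonoidAlgebra.induction_linear with
    | zero => rw [map_zero]
    | add x y hx hy => rw [map_add, map_add, map_add, hx, hy]
    | single g a => simp [ε, inversion]
  refine ⟨⟨M.comap ε, Ideal.comap_isMaximal_of_surjective ε hε⟩, ?_⟩
  refine MaximalSpectrum.ext (Ideal.ext fun x => ?_)
  simp only [conjMaximal, Ideal.mem_comap, inversion_symm]
  rw [hinv]

end Codes

lemma add_self_injective_of_odd {G : Type*} [AddCommGroup G] (hG : Odd (Nat.card G)) :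
    Function.Injective fun g : G => g + g := by
  have h := (nsmulCoprime (G := G) (n := 2) (Nat.coprime_two_right.2 hG)).injective
  simpa only [nsmulCoprime, Equiv.coe_fn_mk, two_nsmul] using h

end CyclicHull

/-! ### The bound for ℤ₄ + vℤ₄ -/

theorem corollary5p3 (n : ℕ) (hn : Odd n) :
    CyclicHull.averageHullDim n < 10 * (n : ℝ) / 9 := by
  open CyclicHull in
  classical
  obtain ⟨k, rfl⟩ : ∃ k, n = k + 1 := Nat.exists_eq_succ_of_ne_zero hn.pos.ne'
  have hS : IsUnramifiedMod4 (AddMonoidAlgebra Z4v (Fin (k + 1))) :=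
    isBooleanMod4_Z4v.isUnramifiedMod4 (add_self_injective_of_odd (by simpa using hn))
  have : Nontrivial Z4v := Finite.one_lt_card_iff_nontrivial.1 (by rw [card_Z4v]; norm_num)
  obtain ⟨m, hm⟩ := exists_conjMaximal_inversion_eq (A := Z4v) (k := k)
  have := Fintype.ofFinite (Ideal (AddMonoidAlgebra Z4v (Fin (k + 1))))
  have h := hS.sum_logb_card_idealHull_lt (inversion Z4v k) m hm
  let e : CyclicCode (k + 1) ≃ Ideal (AddMonoidAlgebra Z4v (Fin (k + 1))) := cyclicCodeEquiv Z4v k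
  have hcard : Fintype.card (CyclicCode (k + 1)) =
      Fintype.card (Ideal (AddMonoidAlgebra Z4v (Fin (k + 1)))) :=
    Fintype.card_congr e
  have hsum : ∑ C : CyclicCode (k + 1), twoDim (hull C.1) =
      ∑ I, Real.logb 2 (Nat.card (idealHull (inversion Z4v k) I)) := by
    refine Fintype.sum_equiv e _ _ fun C => ?_
    rw [twoDim, C.2.card_hull]
    rfl
  -- Here |S| = 16ⁿ with n = k + 1, and 5/18 · 4n = 10n/9.
  have hlog : Real.logb 2 (Nat.card (AddMonoidAlgebra Z4v (Fin (k + 1)))) = 4 * (k + 1) := by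
    rw [Nat.card_congr (wordEquiv Z4v k), Nat.card_fun, card_Z4v, Nat.card_fin,
      show (16 : ℕ) = 2 ^ 4 by norm_num, ← pow_mul]
    push_cast
    rw [Real.logb_pow, Real.logb_self_eq_one (by norm_num)]
    push_cast
    ring
  have hpos : (0 : ℝ) < Fintype.card (CyclicCode (k + 1)) := by
    rw [hcard]
    exact_mod_cast Fintype.card_pos
  rw [averageHullDim, div_lt_iff₀ hpos, hsum, hcard]
  rw [hlog] at h
  refine h.trans_eq ?_
  push_cast
  ring
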